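/- Let $a,b$ be non-zero complex numbers and, for $m\ge 1$, let $\mathcal T_m\in\mathbb C^{2m\times 2m}$ be the block tridiagonal Toeplitz matrix with diagonal blocks $A_0=\begin{pmatrix}0&b\\b&0\end{pmatrix}$, blocks $A_1=\begin{pmatrix}a&0\\0&0\end{pmatrix}$ directly above the diagonal and $A_{-1}=\begin{pmatrix}0&0\\0&a\end{pmatrix}$ directly below it. Let the limiting spectrum be the set of all $z\in\mathbb C$ such that every neighbourhood of $z$ contains an eigenvalue of $\mathcal T_m$ for infinitely many $m$. Let $\Gamma$ be the curve consisting of the points $$\lambda_\pm(\theta)=a\cos\theta\pm\sqrt{b^2-a^2\sin^2\theta},\qquad \theta\in[-\pi,\pi],$$ and let $s=\sqrt{\tfrac12 b^2-a^2}$. (i) The limiting spectrum is contained in $\Gamma$, except perhaps for the points $\pm s$, which can lie in the limiting spectrum outside $\Gamma$ only if $|a^2|>|\tfrac12 b^2-a^2|$. (ii) The exceptions come from simple eigenvalues: for every $\varepsilon>0$ and all sufficiently large $m$, all eigenvalues of $\mathcal T_m$, counted with algebraic multiplicity, lie at distance less than $\varepsilon$ from some point of $\Gamma$, except perhaps for at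 most two, each of which is a simple eigenvalue, one within $\varepsilon$ of $s$ and the other within $\varepsilon$ of $-s$; and such exceptions occur only if $|a^2|>|\tfrac12 b^2-a^2|$. -/

import Mathlib

open Filter

noncomputable section

/-- The diagonal block `A₀`. -/
def blockDiag (b : ℂ) : Matrix (Fin 2) (Fin 2) ℂ := !![0, b; b, 0]

/-- The block `A₁` above the diagonal. -/
def blockSuper (a : ℂ) : Matrix (Fin 2) (Fin 2) ℂ := !![a, 0; 0, 0]

/-- The block `A₋₁` below the diagonal. -/
def blockSub (a : ℂ) : Matrix (Fin 2) (Fin 2) ℂ := !![0, 0; 0, a]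

/-- The `2m × 2m` block tridiagonal Toeplitz matrix. The index `(i, k)` is the position `k` inside
the `i`-th block row (or block column). -/
def toeplitzT (a b : ℂ) (m : ℕ) : Matrix (Fin m × Fin 2) (Fin m × Fin 2) ℂ :=
  Matrix.of fun p q =>
    if p.1 = q.1 then blockDiag b p.2 q.2
    else if (q.1 : ℕ) = (p.1 : ℕ) + 1 then blockSuper a p.2 q.2
    else if (p.1 : ℕ) = (q.1 : ℕ) + 1 then blockSub a p.2 q.2
    else 0

/-- The limiting spectrum of the matrices as `m → ∞`: the points every neighbourhood of which
contains an eigenvalue of the `m`-th matrix for infinitely many `m`. -/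
def limitingSpectrum (a b : ℂ) : Set ℂ :=
  {z | ∀ ε : ℝ, 0 < ε → ∃ᶠ m : ℕ in atTop, ∃ μ ∈ spectrum ℂ (toeplitzT a b m), dist μ z < ε}

/-- The upper branch of the limiting curve (`Complex.sqrt` is the principal square root). -/
def lambdaPlus (a b : ℂ) (θ : ℝ) : ℂ :=
  a * (Real.cos θ : ℂ) + Complex.sqrt (b ^ 2 - a ^ 2 * (Real.sin θ : ℂ) ^ 2)

/-- The lower branch of the limiting curve. -/
def lambdaMinus (a b : ℂ) (θ : ℝ) : ℂ :=
  a * (Real.cos θ : ℂ) - Complex.sqrt (b ^ 2 - a ^ 2 * (Real.sin θ : ℂ) ^ 2)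

/-- The limiting curve, as a subset of the plane. -/
def limitingCurve (a b : ℂ) : Set ℂ :=
  {z | ∃ θ ∈ Set.Icc (-Real.pi) Real.pi, z = lambdaPlus a b θ ∨ z = lambdaMinus a b θ}

/-- The square root `√(b²/2 - a²)`; the possible exceptional points are plus and minus it. -/
def exceptionalRoot (a b : ℂ) : ℂ := Complex.sqrt (b ^ 2 / 2 - a ^ 2)

open Classical in
/-- The multiset of the eigenvalues of the `m`-th matrix, with algebraic multiplicity, whose
distance to the limiting curve is at least `ε`. -/
def eigenvaluesOffCurve (a b : ℂ) (m : ℕ) (ε : ℝ) : Multiset ℂ :=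
  (toeplitzT a b m).charpoly.roots.filter fun μ => ∀ z ∈ limitingCurve a b, ε ≤ dist μ z

end

/-!
Let `μ` be an eigenvalue of the `m`-th matrix, `x` and `y` the even and odd parts of an eigenvector.
Eliminating `y` and rescaling by `pᵢ = (aμ)ⁱ xᵢ` leaves the scalar recurrence
`pᵢ₊₂ = c pᵢ₊₁ - (aμ)² pᵢ` with `c = μ² + a² - b²`, the initial condition `p₁ = (c - a²) p₀` and the
end condition `p_m = 0`. If `r, s` are the two characteristic roots, so `r + s = c` and
`r s = (aμ)²`, then solving the recurrence gives `r ^ m * (r - a²) = s ^ m * (s - a²)`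
(`pow_mul_eq_of_eigenvector`).

The curve is exactly the set where the two roots have equal modulus; the inclusion needed is
`mem_limitingCurve_of_norm_eq`. At distance at least `ε` from the curve, and in the disc of radius
`‖a‖ + ‖b‖` that contains all eigenvalues, compactness therefore gives `‖s‖ ≤ q ‖r‖` with a uniform
`q < 1`. So for large `m` an eigenvalue there forces the dominant root `r` to be close to `a²`. But
`a²` is never a characteristic root: the characteristic polynomial takes the value `a² b² ≠ 0`
there. Hence for large `m` all eigenvalues are within `ε` of the curve (`eventually_near_curve`).

This is stronger than the statement, which allows exceptions near `±√(b²/2 - a²)`: no exception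
occurs, and the limiting spectrum is contained in the curve, which is closed
(`isClosed_limitingCurve`). The clauses about exceptional eigenvalues hold
because the multiset of those eigenvalues is empty for all large `m`.
-/

open Filter

/-! ### The limiting curve -/

/-- Squaring away the root: with `t = cos θ`, the two branches are the solutions of one quadratic
equation with real parameter `t ∈ [-1, 1]`. -/
theorem mem_limitingCurve_iff (a b z : ℂ) :
    z ∈ limitingCurve a b ↔
      ∃ t ∈ Set.Icc (-1 : ℝ) 1, z ^ 2 - 2 * a * z * (t : ℂ) + a ^ 2 - b ^ 2 = 0 := by
  have key : ∀ θ : ℝ, (z = lambdaPlus a b θ ∨ z = lambdaMinus a b θ) ↔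
      z ^ 2 - 2 * a * z * ((Real.cos θ : ℝ) : ℂ) + a ^ 2 - b ^ 2 = 0 := by
    intro θ
    have hw : Complex.sqrt (b ^ 2 - a ^ 2 * (Real.sin θ : ℂ) ^ 2) ^ 2
        = b ^ 2 - a ^ 2 * (Real.sin θ : ℂ) ^ 2 := by
      rw [Complex.sqrt]
      exact Complex.cpow_nat_inv_pow _ two_ne_zero
    have hsc : ((Real.sin θ : ℝ) : ℂ) ^ 2 + ((Real.cos θ : ℝ) : ℂ) ^ 2 = 1 := by
      exact_mod_cast Real.sin_sq_add_cos_sq θ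
    unfold lambdaPlus lambdaMinus
    generalize Complex.sqrt (b ^ 2 - a ^ 2 * (Real.sin θ : ℂ) ^ 2) = w at hw ⊢
    constructor
    · rintro (rfl | rfl) <;> linear_combination hw - a ^ 2 * hsc
    · intro h
      have h2 : (z - (a * ((Real.cos θ : ℝ) : ℂ) + w)) *
          (z - (a * ((Real.cos θ : ℝ) : ℂ) - w)) = 0 := by
        linear_combination h - hw + a ^ 2 * hsc
      rcases mul_eq_zero.1 h2 with h3 | h3
      · exact Or.inl (sub_eq_zero.1 h3)
      · exact Or.inr (sub_eq_zero.1 h3)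
  constructor
  · rintro ⟨θ, -, h⟩
    exact ⟨Real.cos θ, ⟨Real.neg_one_le_cos θ, Real.cos_le_one θ⟩, (key θ).1 h⟩
  · rintro ⟨t, ht, h⟩
    refine ⟨Real.arccos t, ⟨by linarith [Real.arccos_nonneg t, Real.pi_pos],
      Real.arccos_le_pi t⟩, (key _).2 ?_⟩
    rwa [Real.cos_arccos ht.1 ht.2]

theorem isClosed_limitingCurve (a b : ℂ) : IsClosed (limitingCurve a b) := by
  have h : limitingCurve a b = Prod.fst '' {p : ℂ × Set.Icc (-1 : ℝ) 1 |
      p.1 ^ 2 - 2 * a * p.1 * (((p.2 : ℝ)) : ℂ) + a ^ 2 - b ^ 2 = 0} := by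
    ext z
    rw [mem_limitingCurve_iff]
    constructor
    · rintro ⟨t, ht, h⟩
      exact ⟨(z, ⟨t, ht⟩), h, rfl⟩
    · rintro ⟨⟨z', t⟩, h, rfl⟩
      exact ⟨t, t.2, h⟩
  rw [h]
  refine isClosedMap_fst_of_compactSpace _ (isClosed_eq ?_ continuous_const)
  fun_prop

/-- If the two characteristic roots at `μ` have the same modulus, then `μ` lies on the curve: up to
the factor `aμ` they are conjugate points `exp (± iθ)` of the unit circle. -/
theorem mem_limitingCurve_of_norm_eq {a b μ r s : ℂ} (ha : a ≠ 0)
    (hsum : r + s = μ ^ 2 + a ^ 2 - b ^ 2) (hprod : r * s = (a * μ) ^ 2) (hrs : ‖r‖ = ‖s‖) :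
    μ ∈ limitingCurve a b := by
  rw [mem_limitingCurve_iff]
  have hsq : ‖r‖ = ‖a * μ‖ := by
    have h := congrArg norm hprod
    rw [norm_mul, norm_pow, ← hrs, ← sq] at h
    exact (pow_left_inj₀ (norm_nonneg _) (norm_nonneg _) two_ne_zero).1 h
  by_cases hμ : μ = 0
  · subst hμ
    have hr : r = 0 := by simpa using hsq
    have hs : s = 0 := by rw [hr] at hrs; simpa using hrs.symm
    refine ⟨0, by norm_num, ?_⟩
    rw [hr, hs] at hsum
    linear_combination -hsum
  · have haμ : a * μ ≠ 0 := mul_ne_zero ha hμ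
    obtain ⟨u, rfl⟩ : ∃ u, r = a * μ * u := ⟨r / (a * μ), by field_simp⟩
    have hu : ‖u‖ = 1 := by
      rw [norm_mul] at hsq
      have : ‖a * μ‖ ≠ 0 := norm_ne_zero_iff.2 haμ
      exact mul_left_cancel₀ this (by rw [hsq, mul_one])
    have hu0 : u ≠ 0 := by
      rintro rfl
      simp at hu
    have huc : u * (starRingEnd ℂ) u = 1 := by
      rw [Complex.mul_conj, Complex.normSq_eq_norm_sq, hu]
      norm_num
    have hs : s = a * μ * (starRingEnd ℂ) u := by
      apply mul_left_cancel₀ (mul_ne_zero haμ hu0)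
      linear_combination hprod - (a * μ) ^ 2 * huc
    refine ⟨u.re, abs_le.1 (hu ▸ Complex.abs_re_le_norm u), ?_⟩
    have hre : u + (starRingEnd ℂ) u = 2 * (u.re : ℂ) := by
      rw [Complex.add_conj]
      push_cast
      ring
    rw [hs] at hsum
    linear_combination a * μ * hre - hsum

/-! ### Eigenvectors and the scalar recurrence -/

theorem toeplitzT_mulVec_zero (a b : ℂ) (m : ℕ) (v : Fin m × Fin 2 → ℂ) (i : Fin m) :
    (toeplitzT a b m).mulVec v (i, 0) =
      b * v (i, 1) + if h : (i : ℕ) + 1 < m then a * v (⟨i + 1, h⟩, 0) else 0 := by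
  have hterm : ∀ j : Fin m, (toeplitzT a b m) (i, 0) (j, 0) * v (j, 0) +
      (toeplitzT a b m) (i, 0) (j, 1) * v (j, 1) =
      (if i = j then b * v (j, 1) else 0) +
        (if (j : ℕ) = (i : ℕ) + 1 then a * v (j, 0) else 0) := by
    intro j
    by_cases h1 : i = j
    · subst h1
      simp [toeplitzT, blockDiag]
    · by_cases h2 : (j : ℕ) = (i : ℕ) + 1
      · simp [toeplitzT, blockSuper, h1, h2]
      · by_cases h3 : (i : ℕ) = (j : ℕ) + 1
        · simp only [toeplitzT, Matrix.of_apply, if_neg h1, if_neg h2, if_pos h3]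
          simp [blockSub]
        · simp [toeplitzT, h1, h2, h3]
  simp only [Matrix.mulVec, dotProduct, Fintype.sum_prod_type, Fin.sum_univ_two]
  rw [Finset.sum_congr rfl fun j _ => hterm j, Finset.sum_add_distrib, Finset.sum_ite_eq,
    if_pos (Finset.mem_univ i)]
  congr 1
  split_ifs with h
  · rw [Finset.sum_eq_single (⟨i + 1, h⟩ : Fin m)]
    · simp
    · intro j _ hj
      rw [if_neg fun hh => hj (Fin.ext hh)]
    · simp
  · exact Finset.sum_eq_zero fun j _ => if_neg (by omega)

theorem toeplitzT_mulVec_one (a b : ℂ) (m : ℕ) (v : Fin m × Fin 2 → ℂ) (i : Fin m) :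
    (toeplitzT a b m).mulVec v (i, 1) =
      b * v (i, 0) + if 0 < (i : ℕ) then a * v (⟨i - 1, by omega⟩, 1) else 0 := by
  have hterm : ∀ j : Fin m, (toeplitzT a b m) (i, 1) (j, 0) * v (j, 0) +
      (toeplitzT a b m) (i, 1) (j, 1) * v (j, 1) =
      (if i = j then b * v (j, 0) else 0) +
        (if (i : ℕ) = (j : ℕ) + 1 then a * v (j, 1) else 0) := by
    intro j
    by_cases h1 : i = j
    · subst h1
      simp [toeplitzT, blockDiag]
    · by_cases h3 : (i : ℕ) = (j : ℕ) + 1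
      · have h2 : ¬(j : ℕ) = (i : ℕ) + 1 := by omega
        simp only [toeplitzT, Matrix.of_apply, if_neg h1, if_neg h2, if_pos h3]
        simp [blockSub]
      · by_cases h2 : (j : ℕ) = (i : ℕ) + 1
        · simp only [toeplitzT, Matrix.of_apply, if_neg h1, if_pos h2, if_neg h3]
          simp [blockSuper]
        · simp [toeplitzT, h1, h2, h3]
  simp only [Matrix.mulVec, dotProduct, Fintype.sum_prod_type, Fin.sum_univ_two]
  rw [Finset.sum_congr rfl fun j _ => hterm j, Finset.sum_add_distrib, Finset.sum_ite_eq,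
    if_pos (Finset.mem_univ i)]
  congr 1
  split_ifs with h
  · rw [Finset.sum_eq_single (⟨i - 1, by omega⟩ : Fin m)]
    · rw [if_pos]
      simp only
      omega
    · intro j _ hj
      rw [if_neg fun hh => hj (Fin.ext (by simp only; omega))]
    · simp
  · exact Finset.sum_eq_zero fun j _ => if_neg (by omega)

/-- An eigenvalue comes with two sequences, the even and odd parts of an eigenvector. -/
theorem exists_eigen_sequences {a b μ : ℂ} {m : ℕ} (hμ : μ ∈ spectrum ℂ (toeplitzT a b m)) :
    ∃ x y : ℕ → ℂ, (∃ i < m, x i ≠ 0 ∨ y i ≠ 0) ∧ x m = 0 ∧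
      (∀ i < m, μ * x i = b * y i + a * x (i + 1)) ∧
      (0 < m → μ * y 0 = b * x 0) ∧
      (∀ i, i + 1 < m → μ * y (i + 1) = b * x (i + 1) + a * y i) := by
  rw [← Matrix.spectrum_toLin'] at hμ
  obtain ⟨v, hv⟩ := (Module.End.HasEigenvalue.of_mem_spectrum hμ).exists_hasEigenvector
  have hv0 : v ≠ 0 := hv.2
  have hTv : (toeplitzT a b m).mulVec v = μ • v := by simpa using hv.apply_eq_smul
  have hrow : ∀ p, μ * v p = (toeplitzT a b m).mulVec v p := fun p => by simp [hTv]
  refine ⟨fun i => if h : i < m then v (⟨i, h⟩, 0) else 0,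
    fun i => if h : i < m then v (⟨i, h⟩, 1) else 0, ?_, by simp, ?_, ?_, ?_⟩
  · obtain ⟨⟨i, k⟩, hik⟩ := Function.ne_iff.1 hv0
    refine ⟨i, i.2, ?_⟩
    simp only [i.2, dite_true]
    fin_cases k
    · exact Or.inl hik
    · exact Or.inr hik
  · intro i hi
    have h := hrow (⟨i, hi⟩, 0)
    rw [toeplitzT_mulVec_zero] at h
    simp only [hi, dite_true, h]
    split_ifs <;> simp
  · intro hm
    have h := hrow (⟨0, hm⟩, 1)
    rw [toeplitzT_mulVec_one] at h
    simpa [hm] using h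
  · intro i hi
    have h := hrow (⟨i + 1, hi⟩, 1)
    rw [toeplitzT_mulVec_one] at h
    have hi' : i < m := by omega
    simpa [hi, hi'] using h

/-- Gershgorin-type bound, read off at a largest entry of an eigenvector. -/
theorem norm_le_of_mem_spectrum {a b μ : ℂ} {m : ℕ} (hμ : μ ∈ spectrum ℂ (toeplitzT a b m)) :
    ‖μ‖ ≤ ‖a‖ + ‖b‖ := by
  obtain ⟨x, y, ⟨i, hi, hne⟩, hxm, h1, h2, h3⟩ := exists_eigen_sequences hμ
  obtain ⟨j, hj, hmax⟩ := Finset.exists_max_image (Finset.range m)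
    (fun i => max ‖x i‖ ‖y i‖) ⟨i, Finset.mem_range.2 hi⟩
  simp only [Finset.mem_range] at hj hmax
  set M := max ‖x j‖ ‖y j‖ with hM
  have hMpos : 0 < M := by
    refine lt_of_lt_of_le ?_ (hmax i hi)
    rcases hne with h | h
    · exact lt_max_of_lt_left (norm_pos_iff.2 h)
    · exact lt_max_of_lt_right (norm_pos_iff.2 h)
  have hx : ∀ k ≤ m, ‖x k‖ ≤ M := by
    intro k hk
    rcases hk.lt_or_eq with hk | rfl
    · exact (le_max_left _ _).trans (hmax k hk)
    · rw [hxm, norm_zero]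
      exact hMpos.le
  have hy : ∀ k < m, ‖y k‖ ≤ M := fun k hk => (le_max_right _ _).trans (hmax k hk)
  have hcomb : ∀ u w : ℂ, ‖u‖ ≤ M → ‖w‖ ≤ M → ‖b * u + a * w‖ ≤ (‖a‖ + ‖b‖) * M := by
    intro u w hu hw
    refine (norm_add_le _ _).trans ?_
    rw [norm_mul, norm_mul, add_mul, add_comm]
    gcongr
  have hfin : ‖μ‖ * M ≤ (‖a‖ + ‖b‖) * M := by
    rcases max_choice ‖x j‖ ‖y j‖ with hc | hc
    · rw [← hM] at hc
      have h := hcomb (y j) (x (j + 1)) (hy j hj) (hx _ hj)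
      rwa [← h1 j hj, norm_mul, ← hc] at h
    · rw [← hM] at hc
      rcases Nat.eq_zero_or_pos j with rfl | hj0
      · have h := hcomb (x 0) 0 (hx _ hj.le) (by simpa using hMpos.le)
        rwa [mul_zero, add_zero, ← h2 hj, norm_mul, ← hc] at h
      · obtain ⟨k, rfl⟩ := Nat.exists_eq_succ_of_ne_zero hj0.ne'
        have h := hcomb (x (k + 1)) (y k) (hx _ hj.le) (hy k (by omega))
        rwa [← h3 k hj, norm_mul, ← hc] at h
  exact le_of_mul_le_mul_right hfin hMpos

/-- The scalar recurrence for the even part of an eigenvector. -/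
theorem even_part_recurrence {a b μ : ℂ} {m : ℕ} {x y : ℕ → ℂ}
    (h1 : ∀ i < m, μ * x i = b * y i + a * x (i + 1)) (h2 : 0 < m → μ * y 0 = b * x 0)
    (h3 : ∀ i, i + 1 < m → μ * y (i + 1) = b * x (i + 1) + a * y i) :
    (0 < m → a * μ * x 1 = (μ ^ 2 - b ^ 2) * x 0) ∧
      ∀ i, i + 1 < m →
        a * μ * x (i + 2) = (μ ^ 2 + a ^ 2 - b ^ 2) * x (i + 1) - a * μ * x i := by
  constructor
  · intro hm
    linear_combination -b * h2 hm - μ * h1 0 hm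
  · intro i hi
    linear_combination -b * h3 i hi - μ * h1 (i + 1) hi + a * h1 i (by omega)

/-- The eigenvalue `0` occurs only if it lies on the curve. -/
theorem zero_mem_limitingCurve {a b : ℂ} {m : ℕ} (hb : b ≠ 0)
    (h0 : (0 : ℂ) ∈ spectrum ℂ (toeplitzT a b m)) : (0 : ℂ) ∈ limitingCurve a b := by
  rw [mem_limitingCurve_iff]
  refine ⟨0, by norm_num, ?_⟩
  by_contra hab
  obtain ⟨x, y, ⟨i, hi, hne⟩, hxm, h1, h2, h3⟩ := exists_eigen_sequences h0
  obtain ⟨r1, r2⟩ := even_part_recurrence h1 h2 h3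
  have hx : ∀ k ≤ m, x k = 0 := by
    intro k hk
    rcases k with _ | k
    · have h := r1 (by omega)
      have : b ^ 2 * x 0 = 0 := by linear_combination h
      simpa [hb] using this
    · rcases hk.lt_or_eq with hk | hk
      · have h := r2 k hk
        have h' : ((0 : ℂ) ^ 2 - 2 * a * 0 * ((0 : ℝ) : ℂ) + a ^ 2 - b ^ 2) * x (k + 1) = 0 := by
          linear_combination -h
        exact (mul_eq_zero.1 h').resolve_left hab
      · rw [hk, hxm]
  have hy : b * y i = 0 := by
    have h := h1 i hi
    rw [hx (i + 1) hi] at h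
    linear_combination -h
  rcases hne with h | h
  · exact h (hx i hi.le)
  · exact h ((mul_eq_zero.1 hy).resolve_left hb)

/-- The characteristic equation, in terms of the characteristic roots `r, s` of the scalar
recurrence. -/
theorem pow_mul_eq_of_eigenvector {a b μ r s : ℂ} {m : ℕ} (ha : a ≠ 0) (hb : b ≠ 0) (hμ0 : μ ≠ 0)
    (hsum : r + s = μ ^ 2 + a ^ 2 - b ^ 2) (hprod : r * s = (a * μ) ^ 2)
    (hμ : μ ∈ spectrum ℂ (toeplitzT a b m)) : r ^ m * (r - a ^ 2) = s ^ m * (s - a ^ 2) := by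
  obtain ⟨x, y, ⟨i, hi, hne⟩, hxm, h1, h2, h3⟩ := exists_eigen_sequences hμ
  obtain ⟨r1, r2⟩ := even_part_recurrence h1 h2 h3
  have hm : 0 < m := by omega
  have haμ : a * μ ≠ 0 := mul_ne_zero ha hμ0
  -- The scaled sequence solves the recurrence; multiplying by `r - s` also covers `r = s`.
  have hform : ∀ k, (k ≤ m → (r - s) * ((a * μ) ^ k * x k) =
        (r ^ k * (r - a ^ 2) - s ^ k * (s - a ^ 2)) * x 0) ∧
      (k + 1 ≤ m → (r - s) * ((a * μ) ^ (k + 1) * x (k + 1)) =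
        (r ^ (k + 1) * (r - a ^ 2) - s ^ (k + 1) * (s - a ^ 2)) * x 0) := by
    intro k
    induction k with
    | zero =>
      refine ⟨fun _ => by ring, fun _ => ?_⟩
      linear_combination (r - s) * r1 hm - (r - s) * x 0 * hsum
    | succ k ih =>
      refine ⟨ih.2, fun hk => ?_⟩
      have e0 := ih.1 (by omega)
      have e1 := ih.2 (by omega)
      linear_combination (r - s) * (a * μ) ^ (k + 1) * r2 k (by omega) + (r + s) * e1 - r * s * e0
        - (r - s) * (a * μ) ^ (k + 1) * x (k + 1) * hsum
        + (r - s) * ((a * μ) ^ k * x k) * hprod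
  have hend := (hform m).1 le_rfl
  rw [hxm, mul_zero, mul_zero] at hend
  -- The recurrence would propagate `x 0 = 0` to the whole eigenvector.
  have hx0 : x 0 ≠ 0 := by
    intro hx0
    have hx : ∀ k, (k ≤ m → x k = 0) ∧ (k + 1 ≤ m → x (k + 1) = 0) := by
      intro k
      induction k with
      | zero =>
        refine ⟨fun _ => hx0, fun _ => ?_⟩
        have h := r1 hm
        rw [hx0, mul_zero] at h
        exact (mul_eq_zero.1 h).resolve_left haμ
      | succ k ih =>
        refine ⟨ih.2, fun hk => ?_⟩
        have h := r2 k (by omega)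
        rw [ih.1 (by omega), ih.2 (by omega), mul_zero, mul_zero, sub_zero] at h
        exact (mul_eq_zero.1 h).resolve_left haμ
    have hy : b * y i = 0 := by
      have h := h1 i hi
      rw [(hx i).1 hi.le, (hx i).2 hi] at h
      linear_combination -h
    rcases hne with h | h
    · exact h ((hx i).1 hi.le)
    · exact h ((mul_eq_zero.1 hy).resolve_left hb)
  exact sub_eq_zero.1 ((mul_eq_zero.1 hend.symm).resolve_right hx0)

/-! ### Uniform estimates away from the curve -/

/-- The two characteristic roots at `μ`, the dominant one first. -/
theorem exists_ordered_roots (a b μ : ℂ) :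
    ∃ r s : ℂ, r + s = μ ^ 2 + a ^ 2 - b ^ 2 ∧ r * s = (a * μ) ^ 2 ∧ ‖s‖ ≤ ‖r‖ := by
  obtain ⟨d, hd⟩ := IsAlgClosed.exists_pow_nat_eq
    ((μ ^ 2 + a ^ 2 - b ^ 2) ^ 2 - 4 * (a * μ) ^ 2) two_pos
  have hsum : (μ ^ 2 + a ^ 2 - b ^ 2 + d) / 2 + (μ ^ 2 + a ^ 2 - b ^ 2 - d) / 2
      = μ ^ 2 + a ^ 2 - b ^ 2 := by ring
  have hprod : (μ ^ 2 + a ^ 2 - b ^ 2 + d) / 2 * ((μ ^ 2 + a ^ 2 - b ^ 2 - d) / 2)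
      = (a * μ) ^ 2 := by linear_combination -(1 / 4 : ℂ) * hd
  rcases le_total ‖(μ ^ 2 + a ^ 2 - b ^ 2 - d) / 2‖ ‖(μ ^ 2 + a ^ 2 - b ^ 2 + d) / 2‖ with h | h
  · exact ⟨_, _, hsum, hprod, h⟩
  · exact ⟨_, _, by rw [add_comm]; exact hsum, by rw [mul_comm]; exact hprod, h⟩

/-- The triples `(μ, r, s)` where `μ` has norm at most `R` and distance at least `ε` from the curve,
and `r`, `s` are the characteristic roots at `μ` with `‖s‖ ≤ ‖r‖`. -/
def offCurveRoots (a b : ℂ) (R ε : ℝ) : Set (ℂ × ℂ × ℂ) :=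
  {p | ‖p.1‖ ≤ R ∧ (∀ z ∈ limitingCurve a b, ε ≤ dist p.1 z) ∧
    p.2.1 + p.2.2 = p.1 ^ 2 + a ^ 2 - b ^ 2 ∧ p.2.1 * p.2.2 = (a * p.1) ^ 2 ∧ ‖p.2.2‖ ≤ ‖p.2.1‖}

theorem isCompact_offCurveRoots (a b : ℂ) (R ε : ℝ) : IsCompact (offCurveRoots a b R ε) := by
  refine Metric.isCompact_of_isClosed_isBounded ?_ ?_
  · have hdist : IsClosed {p : ℂ × ℂ × ℂ | ∀ z ∈ limitingCurve a b, ε ≤ dist p.1 z} := by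
      simp only [Set.ofPred_forall]
      exact isClosed_biInter fun z _ => isClosed_le continuous_const (by fun_prop)
    have hnorm : IsClosed {p : ℂ × ℂ × ℂ | ‖p.1‖ ≤ R} := isClosed_le (by fun_prop) continuous_const
    have hsum : IsClosed {p : ℂ × ℂ × ℂ | p.2.1 + p.2.2 = p.1 ^ 2 + a ^ 2 - b ^ 2} :=
      isClosed_eq (by fun_prop) (by fun_prop)
    have hprod : IsClosed {p : ℂ × ℂ × ℂ | p.2.1 * p.2.2 = (a * p.1) ^ 2} :=
      isClosed_eq (by fun_prop) (by fun_prop)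
    have hord : IsClosed {p : ℂ × ℂ × ℂ | ‖p.2.2‖ ≤ ‖p.2.1‖} :=
      isClosed_le (by fun_prop) (by fun_prop)
    exact hnorm.inter (hdist.inter (hsum.inter (hprod.inter hord)))
  · -- `r² = c r - (aμ)²` bounds `‖r‖` by `1 + ‖c‖ + ‖aμ‖²`.
    set C : ℝ := R ^ 2 + ‖a‖ ^ 2 + ‖b‖ ^ 2 with hC
    set D : ℝ := (‖a‖ * R) ^ 2 with hD
    refine (Metric.isBounded_closedBall (x := (0 : ℂ × ℂ × ℂ)) (r := R + (1 + C + D))).subset ?_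
    rintro ⟨μ, r, s⟩ ⟨hμ, -, hsum, hprod, hrs⟩
    simp only at hμ hsum hprod hrs
    have hR : 0 ≤ R := (norm_nonneg _).trans hμ
    have hC0 : 0 ≤ C := by positivity
    have hD0 : 0 ≤ D := by positivity
    have hc : ‖r + s‖ ≤ C := by
      rw [hsum, hC]
      refine (norm_sub_le _ _).trans ?_
      rw [norm_pow b]
      gcongr
      refine (norm_add_le _ _).trans ?_
      rw [norm_pow, norm_pow]
      gcongr
    have hp : ‖r * s‖ ≤ D := by
      rw [hprod, hD, norm_pow, norm_mul]
      gcongr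
    have hquad : ‖r‖ * ‖r‖ ≤ C * ‖r‖ + D := by
      rw [← norm_mul]
      have : r * r = (r + s) * r - r * s := by ring
      rw [this]
      refine (norm_sub_le _ _).trans ?_
      rw [norm_mul]
      gcongr
    have hr : ‖r‖ ≤ 1 + C + D := by
      by_contra hlt
      push Not at hlt
      nlinarith [norm_nonneg r]
    rw [mem_closedBall_zero_iff]
    refine max_le (by simp only; linarith) (max_le (by simp only; linarith) ?_)
    simp only
    linarith

/-- On the compact set of off-curve root triples, the ratio of the roots is uniformly less than
`1` in modulus, and the dominant root stays away from `a ^ 2`. -/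
theorem offCurveRoots_uniform {a b : ℂ} (ha : a ≠ 0) (hb : b ≠ 0) (R : ℝ) {ε : ℝ} (hε : 0 < ε) :
    ∃ q δ C : ℝ, 0 ≤ q ∧ q < 1 ∧ 0 < δ ∧ ∀ p ∈ offCurveRoots a b R ε,
      0 < ‖p.2.1‖ ∧ ‖p.2.2‖ ≤ q * ‖p.2.1‖ ∧ δ ≤ ‖p.2.1 - a ^ 2‖ ∧ ‖p.2.2 - a ^ 2‖ ≤ C := by
  have hK := isCompact_offCurveRoots a b R ε
  have hlt : ∀ p ∈ offCurveRoots a b R ε, ‖p.2.2‖ < ‖p.2.1‖ := by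
    rintro ⟨μ, r, s⟩ ⟨-, hoff, hsum, hprod, hrs⟩
    refine lt_of_le_of_ne hrs fun h => ?_
    have := hoff μ (mem_limitingCurve_of_norm_eq ha hsum hprod h.symm)
    rw [dist_self] at this
    linarith
  have hpos : ∀ p ∈ offCurveRoots a b R ε, 0 < ‖p.2.1‖ := fun p hp =>
    (norm_nonneg _).trans_lt (hlt p hp)
  -- The characteristic polynomial `X² - c X + (aμ)²` takes the value `a² b²` at `a²`.
  have hne : ∀ p ∈ offCurveRoots a b R ε, 0 < ‖p.2.1 - a ^ 2‖ := by
    rintro ⟨μ, r, s⟩ ⟨-, -, hsum, hprod, -⟩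
    simp only at hsum hprod
    refine norm_pos_iff.2 fun h => mul_ne_zero (pow_ne_zero 2 ha) (pow_ne_zero 2 hb) ?_
    simp only at h
    linear_combination a ^ 2 * hsum - hprod - (a ^ 2 - s) * h
  rcases (offCurveRoots a b R ε).eq_empty_or_nonempty with hem | hnon
  · refine ⟨0, 1, 0, le_rfl, one_pos, one_pos, fun p hp => ?_⟩
    rw [hem] at hp
    exact hp.elim
  · obtain ⟨p₁, hp₁, hq⟩ := hK.exists_isMaxOn hnon
      (f := fun p : ℂ × ℂ × ℂ => ‖p.2.2‖ / ‖p.2.1‖)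
      (ContinuousOn.div (by fun_prop) (by fun_prop) fun p hp => (hpos p hp).ne')
    obtain ⟨p₂, hp₂, hδ⟩ := hK.exists_isMinOn hnon
      (f := fun p : ℂ × ℂ × ℂ => ‖p.2.1 - a ^ 2‖) (by fun_prop)
    obtain ⟨p₃, hp₃, hC⟩ := hK.exists_isMaxOn hnon
      (f := fun p : ℂ × ℂ × ℂ => ‖p.2.2 - a ^ 2‖) (by fun_prop)
    refine ⟨‖p₁.2.2‖ / ‖p₁.2.1‖, ‖p₂.2.1 - a ^ 2‖, ‖p₃.2.2 - a ^ 2‖, by positivity,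
      (div_lt_one (hpos _ hp₁)).2 (hlt _ hp₁), hne _ hp₂, fun p hp => ⟨hpos p hp, ?_, hδ hp, hC hp⟩⟩
    exact (div_le_iff₀ (hpos p hp)).1 (hq hp)

/-- For large `m` every eigenvalue, without exception, is close to the curve. -/
theorem eventually_near_curve {a b : ℂ} (ha : a ≠ 0) (hb : b ≠ 0) {ε : ℝ} (hε : 0 < ε) :
    ∀ᶠ m : ℕ in atTop, ∀ μ ∈ spectrum ℂ (toeplitzT a b m), ∃ z ∈ limitingCurve a b,
      dist μ z < ε := by
  obtain ⟨q, δ, C, hq0, hq1, hδ, hunif⟩ := offCurveRoots_uniform ha hb (‖a‖ + ‖b‖) hε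
  have hlim : Tendsto (fun m : ℕ => q ^ m * C) atTop (nhds 0) := by
    simpa using (tendsto_pow_atTop_nhds_zero_of_lt_one hq0 hq1).mul_const C
  filter_upwards [hlim.eventually_lt_const hδ] with m hm μ hμ
  by_contra! hoff
  have hμ0 : μ ≠ 0 := by
    rintro rfl
    have := hoff 0 (zero_mem_limitingCurve hb hμ)
    rw [dist_self] at this
    linarith
  obtain ⟨r, s, hsum, hprod, hrs⟩ := exists_ordered_roots a b μ
  obtain ⟨hr, hsr, hrδ, hsC⟩ := hunif (μ, r, s)
    ⟨norm_le_of_mem_spectrum hμ, hoff, hsum, hprod, hrs⟩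
  simp only at hr hsr hrδ hsC
  have heq := congrArg norm (pow_mul_eq_of_eigenvector ha hb hμ0 hsum hprod hμ)
  rw [norm_mul, norm_mul, norm_pow, norm_pow] at heq
  have hle : ‖r‖ ^ m * δ ≤ ‖r‖ ^ m * (q ^ m * C) := by
    calc ‖r‖ ^ m * δ ≤ ‖r‖ ^ m * ‖r - a ^ 2‖ := by gcongr
      _ = ‖s‖ ^ m * ‖s - a ^ 2‖ := heq
      _ ≤ (q * ‖r‖) ^ m * C := by gcongr
      _ = ‖r‖ ^ m * (q ^ m * C) := by rw [mul_pow]; ring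
  exact absurd (le_of_mul_le_mul_left hle (pow_pos hr m)) (not_le.2 hm)

theorem limitingSpectrum_subset_limitingCurve {a b : ℂ} (ha : a ≠ 0) (hb : b ≠ 0) :
    limitingSpectrum a b ⊆ limitingCurve a b := by
  intro z hz
  rw [← (isClosed_limitingCurve a b).closure_eq, Metric.mem_closure_iff]
  intro ε hε
  obtain ⟨m, ⟨μ, hμ, hμz⟩, hnear⟩ :=
    ((hz (ε / 2) (half_pos hε)).and_eventually (eventually_near_curve ha hb (half_pos hε))).exists
  obtain ⟨w, hw, hμw⟩ := hnear μ hμ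
  refine ⟨w, hw, ?_⟩
  linarith [dist_triangle_left z w μ]

theorem eventually_eigenvaluesOffCurve_eq_zero {a b : ℂ} (ha : a ≠ 0) (hb : b ≠ 0) {ε : ℝ}
    (hε : 0 < ε) : ∀ᶠ m : ℕ in atTop, eigenvaluesOffCurve a b m ε = 0 := by
  filter_upwards [eventually_near_curve ha hb hε] with m hm
  classical
  refine Multiset.filter_eq_nil.2 fun μ hμ hoff => ?_
  have hspec : μ ∈ spectrum ℂ (toeplitzT a b m) :=
    Matrix.mem_spectrum_of_isRoot_charpoly (Polynomial.isRoot_of_mem_roots hμ)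
  obtain ⟨z, hz, hlt⟩ := hm μ hspec
  exact absurd (hoff z hz) (not_le.2 hlt)

theorem theorem2p2 (a b : ℂ) (ha : a ≠ 0) (hb : b ≠ 0) :
    -- the limiting spectrum lies on the curve, except perhaps for the two exceptional points
    (∀ z ∈ limitingSpectrum a b, z ∈ limitingCurve a b ∨
      ((z = exceptionalRoot a b ∨ z = -exceptionalRoot a b) ∧
        ‖b ^ 2 / 2 - a ^ 2‖ < ‖a ^ 2‖)) ∧
    -- for large `m` the eigenvalues off the curve are at most two simple ones, one at each
    -- exceptional point, and there are none unless `|a²| > |b²/2 - a²|`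
    (∀ ε : ℝ, 0 < ε → ∀ᶠ m : ℕ in atTop,
      (∃ μ₁ μ₂ : ℂ, dist μ₁ (exceptionalRoot a b) < ε ∧ dist μ₂ (-exceptionalRoot a b) < ε ∧
        eigenvaluesOffCurve a b m ε ≤ {μ₁, μ₂}) ∧
      (∀ μ ∈ eigenvaluesOffCurve a b m ε, (toeplitzT a b m).charpoly.rootMultiplicity μ = 1) ∧
      (eigenvaluesOffCurve a b m ε ≠ 0 → ‖b ^ 2 / 2 - a ^ 2‖ < ‖a ^ 2‖)) := by
  refine ⟨fun z hz => Or.inl (limitingSpectrum_subset_limitingCurve ha hb hz), fun ε hε => ?_⟩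
  filter_upwards [eventually_eigenvaluesOffCurve_eq_zero ha hb hε] with m hm
  rw [hm]
  -- No eigenvalue is exceptional, so the bounding pair may consist of the points `±√(b²/2 - a²)`.
  exact ⟨⟨exceptionalRoot a b, -exceptionalRoot a b, by rwa [dist_self], by rwa [dist_self],
    Multiset.zero_le _⟩, fun μ hμ => absurd hμ (Multiset.notMem_zero μ), fun h => absurd rfl h⟩
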